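/- A quandle is a set $X$ with a binary operation $\triangleright$ such that (i) $a\triangleright a=a$; (ii) for all $a,b$ there is a unique $x$ with $a=x\triangleright b$; (iii) $(a\triangleright b)\triangleright c=(a\triangleright c)\triangleright(b\triangleright c)$. Fix a finite quandle $X$ and an oriented knot $K$. Diagrams of $K$ are oriented plane knot diagrams, identified up to planar isotopy; two diagrams represent the same oriented knot if and only if they are joined by a finite sequence of Reidemeister moves (and planar isotopies). For a diagram $D$ let $R_D$ be its set of arcs. A coloring of $D$ is a map $\mathcal C:R_D\to X$ such that at each crossing, with over-arc $r$ and under-arcs $r_1$ on the right and $r_2$ on the left of the oriented arc $r$, one has $\mathcal C(r_2)=\mathcal C(r_1)\triangleright \mathcal C(r)$. Let $S_D$ be the set of colorings of $D$. If $D'$ is obtained from $D$ by a Reidemeister move or by a planar isotopy, we say that the move takes $\mathcal C\in S_D$ to $\mathcal C'\in S_{D'}$ if $\mathcal C$ and $\mathcal C'$ agree outside of the disc in which the move takes place (for a planar isotopy: if the isotopy carries $\mathcal C$ to $\mathcal C'$); a finite sequence of moves and inverse moves takes $\mathcal C$ to $\mathcal C'$ if there are colorings of the intermediate diagrams such that each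 step takes each coloring to the next one. On the set of all colorings of all diagrams of $K$, write $\mathcal C\sim\mathcal C'$ if some finite sequence of moves takes $\mathcal C$ to $\mathcal C'$; this is an equivalence relation. Theorem. Let $D$ and $D'$ be diagrams of $K$. 1. For every finite sequence of Reidemeister moves from $D$ to $D'$ there is a bijection $\psi:S_D\to S_{D'}$ such that, for all $\mathcal C\in S_D$ and $\mathcal C'\in S_{D'}$, the sequence takes $\mathcal C$ to $\mathcal C'$ if and only if $\mathcal C'=\psi(\mathcal C)$. In particular $\psi(\mathcal C)\sim\mathcal C$ for all $\mathcal C\in S_D$. 2. The multiset of $\sim$-classes of colorings of $D$, in which a class $\kappa$ has multiplicity $\#\{\mathcal C\in S_D:\mathcal C\in\kappa\}$, equals the multiset of $\sim$-classes of colorings of $D'$. That is, the set of equivalence classes of the colorings associated to a diagram, along with their multiplicities, is a knot invariant. -/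

import Mathlib

open scoped Quandles

namespace Knots

/-- One passage through a crossing: the name of the crossing, whether the passage is the over- or
the under-passage, and whether the crossing is positive. -/
structure Letter where
  crossing : ℕ
  isOver : Bool
  positive : Bool

/-- A signed Gauss word: the passages met while travelling once around the oriented knot, starting
from a base point that is not a crossing. -/
abbrev Word := List Letter

namespace Word

/-- For `k ≤ w.length`, the piece of the curve just before the passage `w[k]`, and just after the
passage `w[k - 1]`. The pieces `0` and `w.length` are the two halves of the edge that carries the
base point. -/
def edge (w : Word) (k : ℕ) : Fin (w.length + 1) := Fin.ofNat (w.length + 1) k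

/-- Position `i` of `w` is the over-passage and position `j` the under-passage of one and the same
crossing, of sign `ε` (`true` for positive). -/
def IsCrossing (w : Word) (i j : ℕ) (ε : Bool) : Prop :=
  ∃ c : ℕ, w[i]? = some ⟨c, true, ε⟩ ∧ w[j]? = some ⟨c, false, ε⟩

/-- Two edges lie on the same arc if they meet at the base point or in an over-passage. -/
inductive ArcRel (w : Word) : Fin (w.length + 1) → Fin (w.length + 1) → Prop
  | base : ArcRel w (w.edge 0) (w.edge w.length)
  | overpass (i c : ℕ) (ε : Bool) (h : w[i]? = some ⟨c, true, ε⟩) :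
      ArcRel w (w.edge i) (w.edge (i + 1))

/-- The arcs: the pieces of the curve from one under-passage to the next. A word without crossings
has exactly one arc. -/
def Arc (w : Word) : Type := Quot (ArcRel w)

/-- The arc that contains the `k`-th edge. -/
def arc (w : Word) (k : ℕ) : w.Arc := Quot.mk _ (w.edge k)

/-- The sides of the edges (`true`: left side, `false`: right side) that share a corner at a
crossing. A crossing is positive if the under-strand runs from the right to the left of the
over-strand, and negative if it runs from left to right. -/
inductive RegionRel (w : Word) : Fin (w.length + 1) × Bool → Fin (w.length + 1) × Bool → Prop
  | base (s : Bool) : RegionRel w (w.edge 0, s) (w.edge w.length, s)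
  | pos_out_right (i j : ℕ) (h : w.IsCrossing i j true) :
      RegionRel w (w.edge (i + 1), false) (w.edge j, false)
  | pos_out_left (i j : ℕ) (h : w.IsCrossing i j true) :
      RegionRel w (w.edge (i + 1), true) (w.edge (j + 1), false)
  | pos_in_left (i j : ℕ) (h : w.IsCrossing i j true) :
      RegionRel w (w.edge i, true) (w.edge (j + 1), true)
  | pos_in_right (i j : ℕ) (h : w.IsCrossing i j true) :
      RegionRel w (w.edge i, false) (w.edge j, true)
  | neg_out_right (i j : ℕ) (h : w.IsCrossing i j false) :
      RegionRel w (w.edge (i + 1), false) (w.edge (j + 1), true)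
  | neg_out_left (i j : ℕ) (h : w.IsCrossing i j false) :
      RegionRel w (w.edge (i + 1), true) (w.edge j, true)
  | neg_in_left (i j : ℕ) (h : w.IsCrossing i j false) :
      RegionRel w (w.edge i, true) (w.edge j, false)
  | neg_in_right (i j : ℕ) (h : w.IsCrossing i j false) :
      RegionRel w (w.edge i, false) (w.edge (j + 1), false)

/-- The regions: the complementary discs of the curve in the closed oriented surface that carries
the curve described by the word. -/
def Region (w : Word) : Type := Quot (RegionRel w)

/-- The region on the given side of the `k`-th edge. -/
def region (w : Word) (k : ℕ) (side : Bool) : w.Region := Quot.mk _ (w.edge k, side)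

end Word

/-- An oriented knot diagram in the plane, up to planar isotopy, together with a base point on an
edge that borders the unbounded region.

A connected 4-valent plane graph is determined, up to isotopy of the plane, by the cyclic order of
the edges around each vertex and by the choice of the unbounded region; for a knot diagram the
cyclic orders are given by the signed Gauss word. The word is that of a diagram on the sphere if and
only if the Euler characteristic of the surface that carries it is `2`: with `n` crossings and `2 n`
edges, if and only if it has `n + 2` regions (this is also right for the circle without crossings,
which has `2` regions). -/
structure Diagram where
  word : Word
  /-- No crossing is passed twice as an over-passage or twice as an under-passage. -/
  nodup : (word.map fun l => (l.crossing, l.isOver)).Nodup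
  /-- Each crossing is passed both over and under, with the same sign. -/
  paired : ∀ l ∈ word, (⟨l.crossing, !l.isOver, l.positive⟩ : Letter) ∈ word
  /-- The diagram lies on the sphere. -/
  planar : 2 * Nat.card word.Region = word.length + 4
  /-- The side of the base edge (`true`: left, `false`: right) on which the unbounded region
  lies. -/
  outer : Bool

/-- A coloring of a diagram by a quandle. At each crossing, with over-arc `r` and with under-arcs
`r₁` to the right and `r₂` to the left of `r`, the condition is `C r₂ = C r₁ ▷ C r`. In Mathlib's
notation for quandles `x ▷ y` is `y ◃ x`. The under-strand enters along `r₁` and leaves along `r₂`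
at a positive crossing, and the other way round at a negative one. -/
structure Coloring (D : Diagram) (X : Type*) [Quandle X] where
  color : D.word.Arc → X
  positive : ∀ i j : ℕ, D.word.IsCrossing i j true →
    color (D.word.arc (j + 1)) = color (D.word.arc i) ◃ color (D.word.arc j)
  negative : ∀ i j : ℕ, D.word.IsCrossing i j false →
    color (D.word.arc j) = color (D.word.arc i) ◃ color (D.word.arc (j + 1))

/-- The color of the `k`-th edge, that is, of the arc that contains it. -/
def Coloring.edgeColor {D : Diagram} {X : Type*} [Quandle X] (C : Coloring D X) (k : ℕ) : X :=
  C.color (D.word.arc k)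

instance Coloring.instFinite (D : Diagram) (X : Type*) [Quandle X] [Finite X] :
    Finite (Coloring D X) := by
  have : Finite D.word.Arc := by unfold Word.Arc; infer_instance
  refine Finite.of_injective (fun C : Coloring D X => C.color) ?_
  rintro ⟨c, _, _⟩ ⟨c', _, _⟩ h
  cases h
  rfl

/-! ### Strands that take part in the moves of type II and III -/

/-- The over-strand (`o = true`) or under-strand (`o = false`) of a move of type II, which passes
first the crossing `a` of sign `ε` and then the crossing `b` of opposite sign. -/
def bigonStrand (a b : ℕ) (o ε : Bool) : Word := [⟨a, o, ε⟩, ⟨b, o, !ε⟩]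

/-- Put two passages in the given order, or in the opposite order. -/
def inOrder (α : Bool) (l l' : Letter) : Word := if α then [l, l'] else [l', l]

/-- The three strands (top, middle, bottom) of a move of type III. The top strand crosses the middle
strand at `x` and the bottom strand at `y`, and the middle strand crosses the bottom strand at `z`.
The top strand runs from `x` to `y` if `α = true`, the middle strand from `x` to `z` if `β = true`,
the bottom strand from `y` to `z` if `γ = true`, and in the opposite direction otherwise; the
triangle `x, y, z` is oriented counterclockwise if `s = true` and clockwise if `s = false`. These
data determine the signs: as numbers `±1` they are `s α β` at `x`, `s α γ` at `y`, `s β γ` at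
`z`. -/
def triangleStrands (x y z : ℕ) (α β γ s : Bool) : List Word :=
  [inOrder α ⟨x, true, (α == β) == s⟩ ⟨y, true, (α == γ) == s⟩,
   inOrder β ⟨x, false, (α == β) == s⟩ ⟨z, true, (β == γ) == s⟩,
   inOrder γ ⟨y, false, (α == γ) == s⟩ ⟨z, false, (β == γ) == s⟩]

/-- The elementary moves. The first two change only the description of a diagram, not the diagram
up to planar isotopy; the others are the Reidemeister moves of type I, II and III, for all
orientations, signs and orders in which the curve runs through the strands. The base point always
lies outside of the disc in which the move takes place. -/
inductive Move : Diagram → Diagram → Type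
  /-- Rename the crossings. -/
  | rename (D D' : Diagram) (f : Equiv.Perm ℕ)
      (hw' : D'.word = D.word.map fun l => ⟨f l.crossing, l.isOver, l.positive⟩)
      (ho : D'.outer = D.outer) : Move D D'
  /-- Move the base point to another edge of the unbounded region, which stays the same. -/
  | rebase (D D' : Diagram) (u v : Word) (hw : D.word = u ++ v) (hw' : D'.word = v ++ u)
      (ho : D.word.region u.length D'.outer = D.word.region 0 D.outer) : Move D D'
  /-- Type I: create a kink. -/
  | typeI (D D' : Diagram) (u v : Word) (c : ℕ) (o ε : Bool) (hw : D.word = u ++ v)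
      (hw' : D'.word = u ++ [⟨c, o, ε⟩, ⟨c, !o, ε⟩] ++ v)
      (ho : D'.outer = D.outer) : Move D D'
  /-- Type II: push one strand over another one. The two strands run through the bigon in the same
  direction or in opposite directions. -/
  | typeII (D D' : Diagram) (u v t : Word) (a b : ℕ) (ε : Bool) (s₁ s₂ : Word)
      (hs : [s₁, s₂].Perm [bigonStrand a b true ε, bigonStrand a b false ε] ∨
        [s₁, s₂].Perm [bigonStrand a b true ε, (bigonStrand a b false ε).reverse])
      (hw : D.word = u ++ v ++ t) (hw' : D'.word = u ++ s₁ ++ v ++ s₂ ++ t)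
      (ho : D'.outer = D.outer) : Move D D'
  /-- Type III: push a strand past a crossing. Each of the three strands then passes its two
  crossings in the opposite order. -/
  | typeIII (D D' : Diagram) (u v t q : Word) (x y z : ℕ) (α β γ s : Bool) (s₁ s₂ s₃ : Word)
      (hs : [s₁, s₂, s₃].Perm (triangleStrands x y z α β γ s))
      (hw : D.word = u ++ s₁ ++ v ++ s₂ ++ t ++ s₃ ++ q)
      (hw' : D'.word = u ++ s₁.reverse ++ v ++ s₂.reverse ++ t ++ s₃.reverse ++ q)
      (ho : D'.outer = D.outer) : Move D D'

/-- `m.Corresponds k k'`: outside of the disc of the move, the `k`-th edge before the move is the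
`k'`-th edge after it. -/
def Move.Corresponds : {D D' : Diagram} → Move D D' → ℕ → ℕ → Prop
  | D, _, .rename .., k, k' => k ≤ D.word.length ∧ k' = k
  | _, _, .rebase _ _ u v .., k, k' =>
      (k ≤ u.length ∧ k' = v.length + k) ∨ (k' ≤ v.length ∧ k = u.length + k')
  | D, _, .typeI _ _ u .., k, k' =>
      (k ≤ u.length ∧ k' = k) ∨ (u.length ≤ k ∧ k ≤ D.word.length ∧ k' = k + 2)
  | D, _, .typeII _ _ u v .., k, k' =>
      (k ≤ u.length ∧ k' = k) ∨
      (u.length ≤ k ∧ k ≤ u.length + v.length ∧ k' = k + 2) ∨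
      (u.length + v.length ≤ k ∧ k ≤ D.word.length ∧ k' = k + 4)
  | D, _, .typeIII _ _ u v t .., k, k' =>
      k ≤ D.word.length ∧ k' = k ∧
      k ≠ u.length + 1 ∧
      k ≠ u.length + 2 + v.length + 1 ∧
      k ≠ u.length + 2 + v.length + 2 + t.length + 1

/-- A move takes the coloring `C` to the coloring `C'` if the two agree outside of the disc of the
move. -/
def Move.Transports {D D' : Diagram} (m : Move D D') {X : Type*} [Quandle X]
    (C : Coloring D X) (C' : Coloring D' X) : Prop :=
  ∀ k k' : ℕ, m.Corresponds k k' → C.edgeColor k = C'.edgeColor k'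

/-- A finite sequence of elementary moves and inverses of elementary moves. -/
inductive MoveSeq : Diagram → Diagram → Type
  | nil (D : Diagram) : MoveSeq D D
  | cons {D E F : Diagram} (m : Move D E) (l : MoveSeq E F) : MoveSeq D F
  | consInv {D E F : Diagram} (m : Move E D) (l : MoveSeq E F) : MoveSeq D F

namespace MoveSeq

/-- Concatenation of sequences. -/
def append : {D E F : Diagram} → MoveSeq D E → MoveSeq E F → MoveSeq D F
  | _, _, _, nil _, l' => l'
  | _, _, _, cons m l, l' => cons m (l.append l')
  | _, _, _, consInv m l, l' => consInv m (l.append l')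

/-- The sequence run backwards. -/
def reverse : {D E : Diagram} → MoveSeq D E → MoveSeq E D
  | _, _, nil D => nil D
  | _, _, cons m l => l.reverse.append (consInv m (nil _))
  | _, _, consInv m l => l.reverse.append (cons m (nil _))

/-- A sequence of moves takes `C` to `C'` if there are colorings of the intermediate diagrams such
that each move takes one coloring to the next one. -/
def Transports {X : Type*} [Quandle X] :
    {D D' : Diagram} → MoveSeq D D' → Coloring D X → Coloring D' X → Prop
  | _, _, nil _, C, C' => C = C'
  | _, _, cons m l, C, C' => ∃ C₁, m.Transports C C₁ ∧ l.Transports C₁ C'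
  | _, _, consInv m l, C, C' => ∃ C₁, m.Transports C₁ C ∧ l.Transports C₁ C'

theorem Transports.append {X : Type*} [Quandle X] {D E F : Diagram} (l : MoveSeq D E)
    (l' : MoveSeq E F) {C : Coloring D X} {C₁ : Coloring E X} {C₂ : Coloring F X}
    (h : l.Transports C C₁) (h' : l'.Transports C₁ C₂) : (l.append l').Transports C C₂ := by
  induction l with
  | nil D => cases h; exact h'
  | cons m l ih => obtain ⟨B, hB, h⟩ := h; exact ⟨B, hB, ih l' h h'⟩
  | consInv m l ih => obtain ⟨B, hB, h⟩ := h; exact ⟨B, hB, ih l' h h'⟩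

theorem Transports.reverse {X : Type*} [Quandle X] {D E : Diagram} (l : MoveSeq D E)
    {C : Coloring D X} {C' : Coloring E X} (h : l.Transports C C') :
    l.reverse.Transports C' C := by
  induction l with
  | nil D => exact h.symm
  | cons m l ih => obtain ⟨B, hB, h⟩ := h; exact (ih h).append _ _ ⟨C, hB, rfl⟩
  | consInv m l ih => obtain ⟨B, hB, h⟩ := h; exact (ih h).append _ _ ⟨C, hB, rfl⟩

end MoveSeq

/-- Two diagrams are equivalent if a finite sequence of Reidemeister moves and planar isotopies
joins them. -/
instance Diagram.setoid : Setoid Diagram where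
  r D D' := Nonempty (MoveSeq D D')
  iseqv :=
    { refl := fun D => ⟨.nil D⟩
      symm := fun ⟨l⟩ => ⟨l.reverse⟩
      trans := fun ⟨l⟩ ⟨l'⟩ => ⟨l.append l'⟩ }

/-- An oriented knot (type), as an equivalence class of diagrams. -/
def Knot : Type := Quotient Diagram.setoid

/-- The knot that a diagram represents. -/
def Diagram.knot (D : Diagram) : Knot := Quotient.mk _ D

/-- The set of colorings of a knot: all colorings of all of its diagrams. -/
structure KnotColoring (K : Knot) (X : Type*) [Quandle X] where
  diagram : Diagram
  isDiagram : diagram.knot = K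
  coloring : Coloring diagram X

/-- The relation `∼`: a finite sequence of moves takes one coloring to the other one. -/
instance KnotColoring.setoid (K : Knot) (X : Type*) [Quandle X] : Setoid (KnotColoring K X) where
  r P Q := ∃ l : MoveSeq P.diagram Q.diagram, l.Transports P.coloring Q.coloring
  iseqv :=
    { refl := fun P => ⟨.nil P.diagram, rfl⟩
      symm := fun ⟨l, h⟩ => ⟨l.reverse, h.reverse⟩
      trans := fun ⟨l, h⟩ ⟨l', h'⟩ => ⟨l.append l', h.append _ _ h'⟩ }

/-- The `∼`-classes of colorings of a knot. -/
def ColoringClass (K : Knot) (X : Type*) [Quandle X] : Type _ :=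
  Quotient (KnotColoring.setoid K X)

/-- The class of a coloring of a diagram of `K`. -/
def Coloring.toClass {D : Diagram} {X : Type*} [Quandle X] (C : Coloring D X) {K : Knot}
    (hD : D.knot = K) : ColoringClass K X :=
  Quotient.mk _ ⟨D, hD, C⟩

/-- The classes of the colorings of a diagram, with multiplicities: the class `κ` occurs as often as
there are colorings of `D` in `κ`. -/
noncomputable def Diagram.coloringClasses (D : Diagram) {K : Knot} (hD : D.knot = K) (X : Type*)
    [Quandle X] [Finite X] : Multiset (ColoringClass K X) :=
  letI : Fintype (Coloring D X) := Fintype.ofFinite _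
  (Finset.univ : Finset (Coloring D X)).val.map fun C => C.toClass hD

end Knots

open scoped Quandles

namespace Knots

/-! A coloring of arcs amounts to a coloring of the edges of the Gauss word that closes up at the
base point and is compatible with each passage: over-passages keep the color, under-passages act on
it by the color of the over-arc or by the inverse action (`Coloring.isEdgeColoring`,
`IsEdgeColoring.exists_coloring`). This condition is local, so it suffices to see what one
elementary move does.

Uniqueness: the disc of a move hides only isolated edges, so every passage has a neighboring edge
outside. Colorings that agree outside then have equal over-arc colors, and since each passage is a
bijection of colors, they agree everywhere (`Coloring.ext_of_passages`).

Existence: a move replaces at most three strands, and only the colors at their ends matter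
(`IsEdgeColoring.replace`). The axioms match the moves: idempotence makes a kink invisible,
invertibility cancels the two actions in a bigon, and self-distributivity lets the bottom strand of
a triangle keep its end colors. For type III one over-arc color changes, the one at the crossing of
the middle and bottom strands (`strandRel_triangle`).

Each move is thus a bijection of colorings, hence so is each sequence. It preserves `∼`-classes by
definition, so the multisets of classes agree. -/

/-- The color `a` of an edge before the passage `l` and the color `b` of the edge after it are
compatible, when `g c` is the color of the over-arc at the crossing `c`. -/
def PassageRel {X : Type*} [Quandle X] (g : ℕ → X) (l : Letter) (a b : X) : Prop :=
  (l.isOver = true → g l.crossing = a ∧ b = a) ∧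
  (l.isOver = false → l.positive = true → b = g l.crossing ◃ a) ∧
  (l.isOver = false → l.positive = false → a = g l.crossing ◃ b)

/-- The edge colors `f` are compatible with all the passages of a piece of a Gauss word. -/
def PathColoring {X : Type*} [Quandle X] (g : ℕ → X) (w : Word) (f : ℕ → X) : Prop :=
  ∀ i l, w[i]? = some l → PassageRel g l (f i) (f (i + 1))

/-- The edge colors `f` of a Gauss word come from a coloring of its arcs. -/
def IsEdgeColoring {X : Type*} [Quandle X] (w : Word) (f : ℕ → X) : Prop :=
  f 0 = f w.length ∧ ∃ g, PathColoring g w f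

/-! ### Compatibility of edge colors, at a passage and along a word -/

section PassageRel

variable {X : Type*} [Quandle X] {g g' : ℕ → X} {l : Letter} {a a' b b' : X}

theorem PassageRel.congr_over (h : PassageRel g l a b) (hg : g' l.crossing = g l.crossing) :
    PassageRel g' l a b := by
  unfold PassageRel
  rw [hg]
  exact h

/-- At a passage, the colors before and after it determine each other. -/
theorem PassageRel.left_eq_iff (h : PassageRel g l a b) (h' : PassageRel g l a' b') :
    a = a' ↔ b = b' := by
  obtain ⟨c, o, ε⟩ := l
  cases o with
  | true => rw [(h.1 rfl).2, (h'.1 rfl).2]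
  | false =>
    cases ε with
    | true => rw [h.2.1 rfl rfl, h'.2.1 rfl rfl, Rack.left_cancel]
    | false => rw [h.2.2 rfl rfl, h'.2.2 rfl rfl, Rack.left_cancel]

end PassageRel

section PathColoring

variable {X : Type*} [Quandle X] {g g' : ℕ → X} {f f' : ℕ → X}

/-- Compatibility sees only the crossings named in the word and its own edges; this leaves `g` free
at the crossings that a move creates or changes. -/
theorem PathColoring.congr {w : Word} (h : PathColoring g w f)
    (hg : ∀ l ∈ w, g' l.crossing = g l.crossing) (hf : ∀ k ≤ w.length, f' k = f k) :
    PathColoring g' w f' := by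
  intro i l hi
  obtain ⟨hlt, -⟩ := List.getElem?_eq_some_iff.1 hi
  rw [hf i (by omega), hf (i + 1) (by omega)]
  exact (h i l hi).congr_over (hg l (List.mem_of_getElem? hi))

theorem pathColoring_append {u v : Word} :
    PathColoring g (u ++ v) f ↔
      PathColoring g u f ∧ PathColoring g v fun k => f (u.length + k) := by
  constructor
  · intro h
    refine ⟨fun i l hi => h i l ?_, fun i l hi => ?_⟩
    · obtain ⟨hlt, -⟩ := List.getElem?_eq_some_iff.1 hi
      rwa [List.getElem?_append_left hlt]
    · have := h (u.length + i) l (by rw [List.getElem?_append_right (by omega)]; simpa using hi)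
      rwa [add_assoc] at this
  · rintro ⟨hu, hv⟩ i l hi
    by_cases hlt : i < u.length
    · rw [List.getElem?_append_left hlt] at hi
      exact hu i l hi
    · rw [List.getElem?_append_right (by omega)] at hi
      have := hv _ l hi
      simp only at this
      rwa [← add_assoc, show u.length + (i - u.length) = i by omega] at this

theorem pathColoring_pair {l l' : Letter} :
    PathColoring g [l, l'] f ↔ PassageRel g l (f 0) (f 1) ∧ PassageRel g l' (f 1) (f 2) := by
  constructor
  · intro h
    exact ⟨h 0 l rfl, h 1 l' rfl⟩
  · rintro ⟨h, h'⟩ i m hi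
    match i, hi with
    | 0, hi => cases hi; exact h
    | 1, hi => cases hi; exact h'

end PathColoring

/-! ### Arc colorings as edge colorings -/

section Coloring

variable {X : Type*} [Quandle X] {D : Diagram}

theorem Diagram.over_position_unique {c i j : ℕ} {ε ε' : Bool}
    (hi : D.word[i]? = some ⟨c, true, ε⟩) (hj : D.word[j]? = some ⟨c, true, ε'⟩) : i = j := by
  obtain ⟨hlt, hi⟩ := List.getElem?_eq_some_iff.1 hi
  obtain ⟨hlt', hj⟩ := List.getElem?_eq_some_iff.1 hj
  have := (List.Nodup.getElem_inj_iff D.nodup (i := i) (hi := by simpa) (j := j)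
    (hj := by simpa)).1 (by simp [hi, hj])
  exact this

theorem Coloring.edgeColor_zero (C : Coloring D X) :
    C.edgeColor 0 = C.edgeColor D.word.length :=
  congrArg C.color (Quot.sound Word.ArcRel.base)

theorem Coloring.edgeColor_over (C : Coloring D X) {i c : ℕ} {ε : Bool}
    (h : D.word[i]? = some ⟨c, true, ε⟩) : C.edgeColor (i + 1) = C.edgeColor i :=
  (congrArg C.color (Quot.sound (Word.ArcRel.overpass i c ε h))).symm

theorem Coloring.isEdgeColoring (C : Coloring D X) : IsEdgeColoring D.word C.edgeColor := by
  classical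
  -- The over-arc color of a crossing is read off just before its over-passage. For names that do
  -- not occur, the value is arbitrary.
  refine ⟨C.edgeColor_zero, fun c =>
    if h : ∃ (i : ℕ) (ε : Bool), D.word[i]? = some ⟨c, true, ε⟩ then C.edgeColor h.choose
      else C.edgeColor 0, ?_⟩
  have key : ∀ (i c : ℕ) (ε : Bool), D.word[i]? = some ⟨c, true, ε⟩ →
      (if h : ∃ (i : ℕ) (ε : Bool), D.word[i]? = some ⟨c, true, ε⟩ then C.edgeColor h.choose
        else C.edgeColor 0) = C.edgeColor i := by
    intro i c ε hi
    have h : ∃ (i : ℕ) (ε : Bool), D.word[i]? = some ⟨c, true, ε⟩ := ⟨i, ε, hi⟩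
    rw [dif_pos h, D.over_position_unique h.choose_spec.choose_spec hi]
  rintro j ⟨c, o, ε⟩ hj
  cases o with
  | true =>
    refine ⟨fun _ => ⟨key j c ε hj, C.edgeColor_over hj⟩, ?_, ?_⟩ <;> simp
  | false =>
    obtain ⟨i, hi⟩ := List.mem_iff_getElem?.1 (D.paired _ (List.mem_of_getElem? hj))
    refine ⟨by simp, fun _ hε => ?_, fun _ hε => ?_⟩
    · simp only at hε
      subst hε
      simp only [key i c _ hi]
      exact C.positive i j ⟨c, hi, hj⟩
    · simp only at hε
      subst hε
      simp only [key i c _ hi]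
      exact C.negative i j ⟨c, hi, hj⟩

/-- Compatible colors of the edges define a coloring. -/
theorem IsEdgeColoring.exists_coloring {f : ℕ → X} (h : IsEdgeColoring D.word f) :
    ∃ C : Coloring D X, ∀ k ≤ D.word.length, C.edgeColor k = f k := by
  obtain ⟨h0, g, hg⟩ := h
  have hedge : ∀ k ≤ D.word.length, (D.word.edge k : ℕ) = k := fun k hk =>
    Nat.mod_eq_of_lt (by omega)
  -- The edge colors descend to arcs: closing up handles the gluing at the base point, and the over
  -- clause of `PassageRel` the gluing at an over-passage.
  let col : D.word.Arc → X := Quot.lift (fun e => f e) (by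
    rintro _ _ (_ | ⟨i, c, ε, hi⟩)
    · simpa only [hedge 0 (by omega), hedge _ le_rfl] using h0
    · obtain ⟨hlt, -⟩ := List.getElem?_eq_some_iff.1 hi
      simpa only [hedge i (by omega), hedge (i + 1) (by omega)] using ((hg i _ hi).1 rfl).2.symm)
  have hcol : ∀ k ≤ D.word.length, col (D.word.arc k) = f k := fun k hk =>
    congrArg f (hedge k hk)
  refine ⟨⟨col, ?_, ?_⟩, hcol⟩
  · rintro i j ⟨c, hi, hj⟩
    obtain ⟨hlt, -⟩ := List.getElem?_eq_some_iff.1 hi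
    obtain ⟨hlt', -⟩ := List.getElem?_eq_some_iff.1 hj
    rw [hcol _ (by omega), hcol _ (by omega), hcol _ (by omega), ← ((hg i _ hi).1 rfl).1]
    exact (hg j _ hj).2.1 rfl rfl
  · rintro i j ⟨c, hi, hj⟩
    obtain ⟨hlt, -⟩ := List.getElem?_eq_some_iff.1 hi
    obtain ⟨hlt', -⟩ := List.getElem?_eq_some_iff.1 hj
    rw [hcol _ (by omega), hcol _ (by omega), hcol _ (by omega), ← ((hg i _ hi).1 rfl).1]
    exact (hg j _ hj).2.2 rfl rfl

theorem Coloring.ext_edgeColor {C C' : Coloring D X}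
    (h : ∀ k ≤ D.word.length, C.edgeColor k = C'.edgeColor k) : C = C' := by
  obtain ⟨c, _, _⟩ := C
  obtain ⟨c', _, _⟩ := C'
  have : c = c' := by
    funext a
    obtain ⟨e, rfl⟩ := Quot.exists_rep a
    have he : D.word.edge e = e := Fin.ext (Nat.mod_eq_of_lt e.2)
    have := h e (by omega)
    simpa only [Coloring.edgeColor, Word.arc, he] using this
  subst this
  rfl

/-- Two colorings agree if at each passage they agree before or after it. -/
theorem Coloring.ext_of_passages {C C' : Coloring D X} (h0 : C.edgeColor 0 = C'.edgeColor 0)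
    (h : ∀ i < D.word.length, C.edgeColor i = C'.edgeColor i ∨
      C.edgeColor (i + 1) = C'.edgeColor (i + 1)) : C = C' := by
  obtain ⟨-, g, hg⟩ := C.isEdgeColoring
  obtain ⟨-, g', hg'⟩ := C'.isEdgeColoring
  -- An over-passage has one color on both sides, so agreement on either side is agreement of the
  -- over-arc colors.
  have hgg : ∀ l ∈ D.word, g l.crossing = g' l.crossing := by
    have hover : ∀ c ε, (⟨c, true, ε⟩ : Letter) ∈ D.word → g c = g' c := by
      intro c ε hl
      obtain ⟨i, hi⟩ := List.mem_iff_getElem?.1 hl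
      obtain ⟨hlt, -⟩ := List.getElem?_eq_some_iff.1 hi
      obtain ⟨h₁, h₂⟩ := (hg i _ hi).1 rfl
      obtain ⟨h₁', h₂'⟩ := (hg' i _ hi).1 rfl
      simp only at h₁ h₁'
      rw [h₁, h₁']
      rcases h i hlt with h | h
      · exact h
      · rwa [h₂, h₂'] at h
    rintro ⟨c, o, ε⟩ hl
    cases o with
    | true => exact hover c ε hl
    | false => exact hover c ε (D.paired _ hl)
  have step : ∀ i < D.word.length, (C.edgeColor i = C'.edgeColor i ↔
      C.edgeColor (i + 1) = C'.edgeColor (i + 1)) := by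
    intro i hi
    have hl := List.getElem?_eq_getElem hi
    exact (hg i _ hl).left_eq_iff
      ((hg' i _ hl).congr_over (hgg _ (List.getElem_mem hi)))
  refine Coloring.ext_edgeColor fun k hk => ?_
  cases k with
  | zero => exact h0
  | succ k =>
    have hk : k < D.word.length := hk
    rcases h k hk with h | h
    · exact (step k hk).1 h
    · exact h

end Coloring

/-! ### Crossing names and bigon strands -/

/-- Both passages of `c` already lie in `B`, so another letter at `c` would repeat one of them.
Applied with `B` the strands in the disc, this makes changing `g` at `c` harmless outside. -/
theorem crossing_ne_of_nodup {w A B : Word} {c : ℕ}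
    (h : (w.map fun l => (l.crossing, l.isOver)).Nodup) (hw : w.Perm (A ++ B))
    (hB : ∀ o, ∃ l ∈ B, l.crossing = c ∧ l.isOver = o) : ∀ l ∈ A, l.crossing ≠ c := by
  rintro l hl rfl
  obtain ⟨l', hmem, hc, ho⟩ := hB l.isOver
  have := (hw.map fun l : Letter => (l.crossing, l.isOver)).nodup_iff.1 h
  rw [List.map_append] at this
  refine (List.disjoint_of_nodup_append this) (List.mem_map_of_mem hl) ?_
  rw [← hc, ← ho]
  exact List.mem_map_of_mem (f := fun l : Letter => (l.crossing, l.isOver)) hmem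

/-- `s₁` and `s₂` are the strands of a move of type II, in some order: one of them is the
over-strand, the other one the under-strand, in either direction. -/
def IsBigonPair (a b : ℕ) (ε : Bool) (s₁ s₂ : Word) : Prop :=
  (s₁ = bigonStrand a b true ε ∧
    (s₂ = bigonStrand a b false ε ∨ s₂ = (bigonStrand a b false ε).reverse)) ∨
  (s₂ = bigonStrand a b true ε ∧
      (s₁ = bigonStrand a b false ε ∨ s₁ = (bigonStrand a b false ε).reverse))

theorem isBigonPair_of_perm {a b : ℕ} {ε : Bool} {s₁ s₂ : Word}
    (hs : [s₁, s₂].Perm [bigonStrand a b true ε, bigonStrand a b false ε] ∨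
      [s₁, s₂].Perm [bigonStrand a b true ε, (bigonStrand a b false ε).reverse]) :
    IsBigonPair a b ε s₁ s₂ := by
  have key : ∀ p r : Word, [s₁, s₂].Perm [p, r] → (s₁ = p ∧ s₂ = r) ∨ (s₂ = p ∧ s₁ = r) := by
    intro p r h
    rcases List.perm_pair.1 h with h | h <;> simp only [List.cons.injEq, and_true] at h
    · exact .inl h
    · exact .inr h.symm
  rcases hs with hs | hs <;> rcases key _ _ hs with ⟨rfl, rfl⟩ | ⟨rfl, rfl⟩ <;> simp [IsBigonPair]

theorem length_eq_two_of_bigon {a b : ℕ} {ε : Bool} {s₁ s₂ : Word}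
    (hs : IsBigonPair a b ε s₁ s₂) :
    s₁.length = 2 ∧ s₂.length = 2 := by
  rcases hs with ⟨rfl, rfl | rfl⟩ | ⟨rfl, rfl | rfl⟩ <;> exact ⟨rfl, rfl⟩

/-! ### A move relates a coloring to at most one coloring -/

section Uniqueness

variable {D D' : Diagram} {X : Type*} [Quandle X]

theorem Move.transports_right_unique (m : Move D D') {C : Coloring D X} {C₁ C₂ : Coloring D' X}
    (h₁ : m.Transports C C₁) (h₂ : m.Transports C C₂) : C₁ = C₂ := by
  have h : ∀ k k', m.Corresponds k k' → C₁.edgeColor k' = C₂.edgeColor k' := fun k k' hk =>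
    (h₁ k k' hk).symm.trans (h₂ k k' hk)
  clear h₁ h₂
  -- The base edge is outside the disc, and no two consecutive edges are hidden in it; the rest is
  -- arithmetic of positions.
  suffices (∃ k, m.Corresponds k 0) ∧ ∀ i < D'.word.length,
      (∃ k, m.Corresponds k i) ∨ ∃ k, m.Corresponds k (i + 1) from
    Coloring.ext_of_passages (this.1.elim fun k hk => h k 0 hk) fun i hi =>
      (this.2 i hi).imp (fun ⟨k, hk⟩ => h k i hk) (fun ⟨k, hk⟩ => h k _ hk)
  clear h
  cases m with
  | rename f hw' ho =>
    simp only [Move.Corresponds, hw', List.length_map]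
    exact ⟨⟨0, by omega⟩, fun i hi => .inl ⟨i, by omega⟩⟩
  | rebase u v hw hw' ho =>
    simp only [Move.Corresponds, hw', List.length_append]
    refine ⟨⟨u.length, by omega⟩, fun i hi => .inl ?_⟩
    rcases le_total i v.length with hi' | hi'
    · exact ⟨u.length + i, by omega⟩
    · exact ⟨i - v.length, by omega⟩
  | typeI u v c o ε hw hw' ho =>
    simp only [Move.Corresponds, hw, hw', List.length_append, List.length_cons, List.length_nil]
    refine ⟨⟨0, by omega⟩, fun i hi => ?_⟩
    rcases le_or_gt i u.length with hi' | hi'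
    · exact .inl ⟨i, by omega⟩
    · exact .inr ⟨i - 1, by omega⟩
  | typeII u v t a b ε s₁ s₂ hs hw hw' ho =>
    have hlen := length_eq_two_of_bigon (isBigonPair_of_perm hs)
    simp only [Move.Corresponds, hw, hw', List.length_append, hlen.1, hlen.2]
    refine ⟨⟨0, by omega⟩, fun i hi => ?_⟩
    rcases le_or_gt i u.length with hi' | hi'
    · exact .inl ⟨i, by omega⟩
    rcases le_or_gt i (u.length + 1) with hi'' | hi''
    · exact .inr ⟨i - 1, by omega⟩
    rcases le_or_gt i (u.length + v.length + 2) with hi'' | hi''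
    · exact .inl ⟨i - 2, by omega⟩
    · exact .inr ⟨i - 3, by omega⟩
  | typeIII u v t q x y z α β γ s s₁ s₂ s₃ hs hw hw' ho =>
    simp only [Move.Corresponds, hw, hw', List.length_append, List.length_reverse]
    refine ⟨⟨0, by omega⟩, fun i hi => ?_⟩
    by_cases hi' : i = u.length + 1 ∨ i = u.length + 2 + v.length + 1 ∨
      i = u.length + 2 + v.length + 2 + t.length + 1
    · exact .inr ⟨i + 1, by omega⟩
    · exact .inl ⟨i, by omega⟩

theorem Move.transports_left_unique (m : Move D D') {C₁ C₂ : Coloring D X} {C : Coloring D' X}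
    (h₁ : m.Transports C₁ C) (h₂ : m.Transports C₂ C) : C₁ = C₂ := by
  have h : ∀ k k', m.Corresponds k k' → C₁.edgeColor k = C₂.edgeColor k := fun k k' hk =>
    (h₁ k k' hk).trans (h₂ k k' hk).symm
  clear h₁ h₂
  suffices (∃ k, m.Corresponds 0 k) ∧ ∀ i < D.word.length,
      (∃ k, m.Corresponds i k) ∨ ∃ k, m.Corresponds (i + 1) k from
    Coloring.ext_of_passages (this.1.elim fun k hk => h 0 k hk) fun i hi =>
      (this.2 i hi).imp (fun ⟨k, hk⟩ => h i k hk) (fun ⟨k, hk⟩ => h _ k hk)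
  clear h
  cases m with
  | rename f hw' ho =>
    simp only [Move.Corresponds]
    exact ⟨⟨0, by omega⟩, fun i hi => .inl ⟨i, by omega⟩⟩
  | rebase u v hw hw' ho =>
    simp only [Move.Corresponds, hw, List.length_append]
    refine ⟨⟨v.length, by omega⟩, fun i hi => .inl ?_⟩
    rcases le_total i u.length with hi' | hi'
    · exact ⟨v.length + i, by omega⟩
    · exact ⟨i - u.length, by omega⟩
  | typeI u v c o ε hw hw' ho =>
    simp only [Move.Corresponds, hw, List.length_append]
    refine ⟨⟨0, by omega⟩, fun i hi => .inl ?_⟩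
    rcases le_or_gt i u.length with hi' | hi'
    · exact ⟨i, by omega⟩
    · exact ⟨i + 2, by omega⟩
  | typeII u v t a b ε s₁ s₂ hs hw hw' ho =>
    simp only [Move.Corresponds, hw, List.length_append]
    refine ⟨⟨0, by omega⟩, fun i hi => .inl ?_⟩
    rcases le_or_gt i u.length with hi' | hi'
    · exact ⟨i, by omega⟩
    rcases le_or_gt i (u.length + v.length) with hi'' | hi''
    · exact ⟨i + 2, by omega⟩
    · exact ⟨i + 4, by omega⟩
  | typeIII u v t q x y z α β γ s s₁ s₂ s₃ hs hw hw' ho =>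
    simp only [Move.Corresponds, hw, List.length_append]
    refine ⟨⟨0, by omega⟩, fun i hi => ?_⟩
    by_cases hi' : i = u.length + 1 ∨ i = u.length + 2 + v.length + 1 ∨
      i = u.length + 2 + v.length + 2 + t.length + 1
    · exact .inr ⟨i + 1, by omega⟩
    · exact .inl ⟨i, by omega⟩

end Uniqueness

/-! ### Quandle identities for both signs of a crossing -/

section SignedAction

variable {X : Type*} [Quandle X]

/-- The action of `a` on `b` at a crossing that is passed under an arc of color `a`: `a ◃ b` if the
crossing is positive, and `a ◃⁻¹ b` if it is negative. -/
def signedAct (ε : Bool) (a b : X) : X := if ε then a ◃ b else a ◃⁻¹ b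

theorem signedAct_self (ε : Bool) (a : X) : signedAct ε a a = a := by
  cases ε <;> simp [signedAct]

theorem signedAct_not_signedAct (ε : Bool) (a b : X) :
    signedAct (!ε) a (signedAct ε a b) = b := by
  cases ε <;> simp [signedAct]

theorem signedAct_signedAct_not (ε : Bool) (a b : X) :
    signedAct ε a (signedAct (!ε) a b) = b := by
  cases ε <;> simp [signedAct]

theorem signedAct_injective (ε : Bool) (a : X) : Function.Injective (signedAct ε a) :=
  Function.LeftInverse.injective (signedAct_not_signedAct ε a)

/-- Acting by `a` is an automorphism of the quandle, hence so is its inverse, and automorphisms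
respect both `◃` and `◃⁻¹`. -/
theorem signedAct_distrib (δ ε : Bool) (a b c : X) :
    signedAct δ a (signedAct ε b c) = signedAct ε (signedAct δ a b) (signedAct δ a c) := by
  have hpos : ∀ (δ : Bool) (b c : X),
      signedAct δ a (b ◃ c) = signedAct δ a b ◃ signedAct δ a c := by
    intro δ b c
    cases δ with
    | true => exact Shelf.self_distrib
    | false =>
      refine (Rack.left_cancel a).1 ?_
      simp [signedAct, Shelf.self_distrib (x := a)]
  cases ε with
  | true => exact hpos δ b c
  | false =>
    -- Acting with the image of `b` undoes the inverse action and reduces to the positive case at `b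
    -- ◃⁻¹ c`.
    refine (Rack.left_cancel (signedAct δ a b)).1 ?_
    have := hpos δ b (b ◃⁻¹ c)
    simp only [signedAct, Bool.false_eq_true, if_false, Rack.act_invAct_eq] at this ⊢
    exact this.symm

theorem passageRel_over {g : ℕ → X} {c : ℕ} {ε : Bool} {a b : X} :
    PassageRel g ⟨c, true, ε⟩ a b ↔ g c = a ∧ b = a := by
  simp [PassageRel]

theorem passageRel_under {g : ℕ → X} {c : ℕ} {ε : Bool} {a b : X} :
    PassageRel g ⟨c, false, ε⟩ a b ↔ b = signedAct ε (g c) a := by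
  cases ε with
  | true => simp [PassageRel, signedAct]
  | false =>
    simp only [PassageRel, signedAct]
    constructor
    · rintro ⟨-, -, h⟩
      simp [h trivial trivial]
    · rintro rfl
      simp

end SignedAction

/-! ### Strands with prescribed end colors -/

/-- The piece `s` of a Gauss word, with over-arcs colored by `g`, can be colored so that its first
edge has the color `a` and its last edge the color `b`. -/
def StrandRel {X : Type*} [Quandle X] (g : ℕ → X) (s : Word) (a b : X) : Prop :=
  ∃ h : ℕ → X, PathColoring g s h ∧ h 0 = a ∧ h s.length = b

section StrandRel

variable {X : Type*} [Quandle X] {g g' : ℕ → X} {f : ℕ → X} {a b : X}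

theorem strandRel_nil : StrandRel g [] a b ↔ b = a := by
  constructor
  · rintro ⟨h, -, rfl, rfl⟩
    rfl
  · rintro rfl
    exact ⟨fun _ => b, fun i l hi => by simp at hi, rfl, rfl⟩

theorem strandRel_pair {l l' : Letter} :
    StrandRel g [l, l'] a b ↔ ∃ m, PassageRel g l a m ∧ PassageRel g l' m b := by
  constructor
  · rintro ⟨h, hp, rfl, rfl⟩
    exact ⟨h 1, pathColoring_pair.1 hp⟩
  · rintro ⟨m, h₁, h₂⟩
    exact ⟨fun | 0 => a | 1 => m | _ => b, pathColoring_pair.2 ⟨h₁, h₂⟩, rfl, rfl⟩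

theorem PathColoring.glue {u v : Word} {f₁ f₂ : ℕ → X} (h₁ : PathColoring g u f₁)
    (h₂ : PathColoring g v f₂) (h : f₁ u.length = f₂ 0) :
    ∃ f, PathColoring g (u ++ v) f ∧ (∀ k ≤ u.length, f k = f₁ k) ∧
      ∀ k ≤ v.length, f (u.length + k) = f₂ k := by
  have hl : ∀ k ≤ u.length, (if k ≤ u.length then f₁ k else f₂ (k - u.length)) = f₁ k :=
    fun k hk => if_pos hk
  -- At the seam `k = 0` the first branch is taken; there the matching condition `h` is needed.
  have hr : ∀ k, (if u.length + k ≤ u.length then f₁ (u.length + k)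
      else f₂ (u.length + k - u.length)) = f₂ k := by
    intro k
    cases k with
    | zero => simpa using h
    | succ k => rw [if_neg (by omega), Nat.add_sub_cancel_left]
  exact ⟨fun k => if k ≤ u.length then f₁ k else f₂ (k - u.length),
    pathColoring_append.2 ⟨h₁.congr (fun _ _ => rfl) hl, h₂.congr (fun _ _ => rfl) fun k _ => hr k⟩,
    hl, fun k _ => hr k⟩

/-- Join two colored pieces by a strand. -/
theorem PathColoring.append_strand {u s v : Word} {f₁ f₂ : ℕ → X} (h₁ : PathColoring g u f₁)
    (hs : StrandRel g s (f₁ u.length) (f₂ 0)) (h₂ : PathColoring g v f₂) :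
    ∃ f, PathColoring g (u ++ s ++ v) f ∧ (∀ k ≤ u.length, f k = f₁ k) ∧
      ∀ k ≤ v.length, f (u.length + s.length + k) = f₂ k := by
  obtain ⟨h, hp, h0, h1⟩ := hs
  obtain ⟨F, hF, hFu, hFs⟩ := h₁.glue hp h0.symm
  have hlen : (u ++ s).length = u.length + s.length := List.length_append
  obtain ⟨F', hF', hl, hr⟩ := hF.glue h₂ (by rw [hlen, hFs _ le_rfl, h1])
  rw [hlen] at hl hr
  exact ⟨F', hF', fun k hk => (hl k (by omega)).trans (hFu k hk), hr⟩

/-- Replace three strands of a colored word. -/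
theorem PathColoring.replace {u v t q s₁ s₂ s₃ s₁' s₂' s₃' : Word}
    (h : PathColoring g (u ++ s₁ ++ v ++ s₂ ++ t ++ s₃ ++ q) f)
    (hg : ∀ l ∈ u ++ v ++ t ++ q, g' l.crossing = g l.crossing)
    (h₁ : StrandRel g' s₁' (f u.length) (f (u.length + s₁.length)))
    (h₂ : StrandRel g' s₂' (f (u.length + s₁.length + v.length))
      (f (u.length + s₁.length + v.length + s₂.length)))
    (h₃ : StrandRel g' s₃' (f (u.length + s₁.length + v.length + s₂.length + t.length))
      (f (u.length + s₁.length + v.length + s₂.length + t.length + s₃.length))) :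
    ∃ f', PathColoring g' (u ++ s₁' ++ v ++ s₂' ++ t ++ s₃' ++ q) f' ∧
      (∀ k ≤ u.length, f' k = f k) ∧
      (∀ k ≤ v.length, f' (u.length + s₁'.length + k) = f (u.length + s₁.length + k)) ∧
      (∀ k ≤ t.length, f' (u.length + s₁'.length + v.length + s₂'.length + k) =
        f (u.length + s₁.length + v.length + s₂.length + k)) ∧
      ∀ k ≤ q.length,
        f' (u.length + s₁'.length + v.length + s₂'.length + t.length + s₃'.length + k) =
        f (u.length + s₁.length + v.length + s₂.length + t.length + s₃.length + k) := by
  simp only [pathColoring_append, List.length_append] at h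
  -- The colors inside the old strands are dropped; the new strands only have to meet the same end
  -- colors.
  obtain ⟨⟨⟨⟨⟨⟨hu, -⟩, hv⟩, -⟩, ht⟩, -⟩, hq⟩ := h
  have hg' : ∀ w : Word, (∀ l ∈ w, l ∈ u ++ v ++ t ++ q) → ∀ l ∈ w,
    g' l.crossing = g l.crossing := fun w hw l hl => hg l (hw l hl)
  replace hu := hu.congr (f' := f) (hg' u (by simp +contextual)) fun _ _ => rfl
  replace hv := hv.congr (hg' v (by simp +contextual)) fun _ _ => rfl
  replace ht := ht.congr (hg' t (by simp +contextual)) fun _ _ => rfl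
  replace hq := hq.congr (hg' q (by simp +contextual)) fun _ _ => rfl
  obtain ⟨F₁, hF₁, hu₁, hv₁⟩ := hu.append_strand h₁ hv
  have len₁ : (u ++ s₁' ++ v).length = u.length + s₁'.length + v.length := by
    simp only [List.length_append]
  obtain ⟨F₂, hF₂, hu₂, ht₂⟩ := hF₁.append_strand (s := s₂')
    (by rwa [len₁, hv₁ _ le_rfl]) ht
  have len₂ : (u ++ s₁' ++ v ++ s₂' ++ t).length =
    u.length + s₁'.length + v.length + s₂'.length + t.length := by
    simp only [List.length_append]
  rw [len₁] at hu₂ ht₂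
  obtain ⟨F₃, hF₃, hu₃, hq₃⟩ := hF₂.append_strand (s := s₃')
    (by rwa [len₂, ht₂ _ le_rfl]) hq
  rw [len₂] at hu₃ hq₃
  refine ⟨F₃, hF₃, fun k hk => ?_, fun k hk => ?_, fun k hk => ?_, hq₃⟩
  · rw [hu₃ _ (by omega), hu₂ _ (by omega), hu₁ _ hk]
  · rw [hu₃ _ (by omega), hu₂ _ (by omega), hv₁ _ hk]
  · rw [hu₃ _ (by omega), ht₂ _ hk]

theorem PathColoring.strands {u v t q s₁ s₂ s₃ : Word}
    (h : PathColoring g (u ++ s₁ ++ v ++ s₂ ++ t ++ s₃ ++ q) f) :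
    StrandRel g s₁ (f u.length) (f (u.length + s₁.length)) ∧
    StrandRel g s₂ (f (u.length + s₁.length + v.length))
      (f (u.length + s₁.length + v.length + s₂.length)) ∧
    StrandRel g s₃ (f (u.length + s₁.length + v.length + s₂.length + t.length))
      (f (u.length + s₁.length + v.length + s₂.length + t.length + s₃.length)) := by
  simp only [pathColoring_append, List.length_append] at h
  obtain ⟨⟨⟨⟨⟨⟨-, h₁⟩, -⟩, h₂⟩, -⟩, h₃⟩, -⟩ := h
  exact ⟨⟨_, h₁, rfl, rfl⟩, ⟨_, h₂, rfl, rfl⟩, ⟨_, h₃, rfl, rfl⟩⟩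

/-! ### The strands of the moves -/

/-- The over-arc of a kink is adjacent to its under-passage, so one color acts on itself;
idempotence concludes, with injectivity if the under-passage comes first. -/
theorem eq_of_strandRel_kink {c : ℕ} {o ε : Bool}
    (h : StrandRel g [⟨c, o, ε⟩, ⟨c, !o, ε⟩] a b) : b = a := by
  obtain ⟨m, h₁, h₂⟩ := strandRel_pair.1 h
  cases o with
  | true =>
    obtain ⟨hg, rfl⟩ := passageRel_over.1 h₁
    rw [passageRel_under.1 h₂, hg, signedAct_self]
  | false =>
    obtain ⟨hg, rfl⟩ := passageRel_over.1 h₂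
    have h₁ := passageRel_under.1 h₁
    rw [hg] at h₁
    exact signedAct_injective ε b ((signedAct_self ε b).trans h₁)

theorem strandRel_kink {c : ℕ} (hc : g c = a) (o ε : Bool) :
    StrandRel g [⟨c, o, ε⟩, ⟨c, !o, ε⟩] a a := by
  refine strandRel_pair.2 ⟨a, ?_⟩
  cases o <;> simp [passageRel_over, passageRel_under, hc, signedAct_self]

theorem strandRel_bigon_over {x y : ℕ} {ε : Bool} :
    StrandRel g (bigonStrand x y true ε) a b ↔ g x = a ∧ g y = a ∧ b = a := by
  simp only [bigonStrand, strandRel_pair, passageRel_over]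
  constructor
  · rintro ⟨m, ⟨h₁, rfl⟩, h₂, h₃⟩
    exact ⟨h₁, h₂, h₃⟩
  · rintro ⟨h₁, h₂, h₃⟩
    exact ⟨a, ⟨h₁, rfl⟩, h₂, h₃⟩

/-- The two crossings have opposite signs and equal over-arc colors, so their actions cancel. -/
theorem strandRel_bigon_under {x y : ℕ} {ε : Bool} (h : g x = g y) :
    StrandRel g (bigonStrand x y false ε) a b ↔ b = a := by
  simp [bigonStrand, strandRel_pair, passageRel_under, h, signedAct_not_signedAct]

theorem strandRel_bigon_under_reverse {x y : ℕ} {ε : Bool} (h : g x = g y) :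
    StrandRel g (bigonStrand x y false ε).reverse a b ↔ b = a := by
  simp [bigonStrand, strandRel_pair, passageRel_under, h, signedAct_signedAct_not]

/-- The over-arc colors after a move of type III: only that of the crossing of the middle strand
with the bottom strand changes. -/
def triangleColors (g : ℕ → X) (x z : ℕ) (α s : Bool) : ℕ → X :=
  Function.update g z (signedAct (!(α == s)) (g x) (g z))

theorem eq_of_strandRel_top {x y : ℕ} {α ε δ : Bool}
    (h : StrandRel g (inOrder α ⟨x, true, ε⟩ ⟨y, true, δ⟩) a b) : g x = g y := by
  cases α <;> simp only [inOrder, Bool.false_eq_true, if_false, if_true, strandRel_pair,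
    passageRel_over] at h <;> obtain ⟨m, ⟨h₁, rfl⟩, h₂, -⟩ := h
  · exact h₂.trans h₁.symm
  · exact h₁.trans h₂.symm

/-- A strand of a move of type III can be colored after the move with the same colors at its ends
as before. -/
theorem strandRel_triangle {x y z : ℕ} {α β γ s : Bool} {w : Word} (hxy : g x = g y)
    (hxz : x ≠ z) (hyz : y ≠ z) (hw : w ∈ triangleStrands x y z α β γ s)
    (h : StrandRel g w a b) : StrandRel (triangleColors g x z α s) w.reverse a b := by
  have gx : triangleColors g x z α s x = g x := Function.update_of_ne hxz _ _
  have gy : triangleColors g x z α s y = g x := (Function.update_of_ne hyz _ _).trans hxy.symm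
  -- The move carries `z` to the other side of the top strand, so the middle color there changes by
  -- the top color `g x`. For either `β` the sign of this action is `!(α == s)`: if `β = true`, the
  -- passage under `x` before `z` is undone; if `β = false`, it now precedes `z`.
  have gz : triangleColors g x z α s z = signedAct (!(α == s)) (g x) (g z) :=
    Function.update_self ..
  have εt : ((α == true) == s) = (α == s) := by simp
  have εf : ((α == false) == s) = !(α == s) := by cases α <;> cases s <;> rfl
  simp only [triangleStrands, List.mem_cons, List.not_mem_nil, or_false] at hw
  rcases hw with rfl | rfl | rfl
  · cases α <;> simp only [inOrder, Bool.false_eq_true, if_false, if_true, strandRel_pair,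
      List.reverse_cons, List.reverse_nil, List.nil_append, List.cons_append,
      passageRel_over, gx, gy, ← hxy] at h ⊢ <;> obtain ⟨m, ⟨h₁, rfl⟩, h₂, h₃⟩ := h <;>
      exact ⟨m, ⟨h₁, rfl⟩, h₂, h₃⟩
  · cases β <;> simp only [inOrder, Bool.false_eq_true, if_false, if_true, strandRel_pair,
      List.reverse_cons, List.reverse_nil, List.nil_append, List.cons_append,
      passageRel_over, passageRel_under, gx, gz, εt, εf] at h ⊢
    · obtain ⟨m, ⟨h₁, rfl⟩, rfl⟩ := h
      exact ⟨_, rfl, by rw [h₁], rfl⟩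
    · obtain ⟨m, rfl, h₁, rfl⟩ := h
      exact ⟨a, ⟨by rw [h₁, signedAct_not_signedAct], rfl⟩, rfl⟩
  · cases γ <;> simp only [inOrder, Bool.false_eq_true, if_false, if_true, strandRel_pair,
      List.reverse_cons, List.reverse_nil, List.nil_append, List.cons_append,
      passageRel_under, gy, gz, εt, εf, ← hxy] at h ⊢
    -- Bottom strand: acting by `y` and by `z` in the other order is self-distributivity, with the
    -- new color at `z` as the conjugated one.
    · obtain ⟨m, rfl, rfl⟩ := h
      exact ⟨_, rfl, signedAct_distrib ..⟩
    · obtain ⟨m, rfl, rfl⟩ := h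
      exact ⟨_, rfl, by rw [signedAct_distrib (α == s), signedAct_signedAct_not]⟩

/-- Each sign depends on two of the directions, so reversing all three preserves it. Hence the
inverse of a type III move is again of type III. -/
theorem triangleStrands_reverse (x y z : ℕ) (α β γ s : Bool) :
    (triangleStrands x y z α β γ s).map List.reverse =
      triangleStrands x y z (!α) (!β) (!γ) s := by
  cases α <;> cases β <;> cases γ <;> rfl

end StrandRel

/-! ### A move takes each coloring to some coloring, in both directions -/

section Existence

variable {D D' : Diagram} {X : Type*} [Quandle X]

/-- Replace three strands of a closed colored word. -/
theorem IsEdgeColoring.replace {w w' u v t q s₁ s₂ s₃ s₁' s₂' s₃' : Word} {g f : ℕ → X}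
    (g' : ℕ → X) (hw : w = u ++ s₁ ++ v ++ s₂ ++ t ++ s₃ ++ q)
    (hw' : w' = u ++ s₁' ++ v ++ s₂' ++ t ++ s₃' ++ q)
    (h0 : f 0 = f w.length) (h : PathColoring g w f)
    (hg : ∀ l ∈ u ++ v ++ t ++ q, g' l.crossing = g l.crossing)
    (h₁ : StrandRel g' s₁' (f u.length) (f (u.length + s₁.length)))
    (h₂ : StrandRel g' s₂' (f (u.length + s₁.length + v.length))
      (f (u.length + s₁.length + v.length + s₂.length)))
    (h₃ : StrandRel g' s₃' (f (u.length + s₁.length + v.length + s₂.length + t.length))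
      (f (u.length + s₁.length + v.length + s₂.length + t.length + s₃.length))) :
    ∃ f', IsEdgeColoring w' f' ∧
      (∀ k k', k' ≤ u.length → k' = k → f k = f' k') ∧
      (∀ k k', u.length + s₁'.length ≤ k' → k' ≤ u.length + s₁'.length + v.length →
        k + s₁'.length = k' + s₁.length → f k = f' k') ∧
      (∀ k k', u.length + s₁'.length + v.length + s₂'.length ≤ k' →
        k' ≤ u.length + s₁'.length + v.length + s₂'.length + t.length →
        k + s₁'.length + s₂'.length = k' + s₁.length + s₂.length → f k = f' k') ∧
      ∀ k k', u.length + s₁'.length + v.length + s₂'.length + t.length + s₃'.length ≤ k' →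
        k' ≤ w'.length →
        k + s₁'.length + s₂'.length + s₃'.length = k' + s₁.length + s₂.length + s₃.length →
        f k = f' k' := by
  subst hw hw'
  obtain ⟨f', hf', hu, hv, ht, hq⟩ := h.replace hg h₁ h₂ h₃
  simp only [List.length_append] at h0 ⊢
  refine ⟨f', ⟨?_, g', hf'⟩, ?_, ?_, ?_, ?_⟩
  · simp only [List.length_append]
    -- The two halves of the base edge lie in `u` and `q`, which are kept, so the word still closes
    -- up.
    rw [hu 0 (by omega), hq _ le_rfl, h0]
  · rintro k _ hk rfl
    exact (hu _ hk).symm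
  · intro k k' hk hk' he
    have := hv (k' - (u.length + s₁'.length)) (by omega)
    rw [show u.length + s₁'.length + (k' - (u.length + s₁'.length)) = k' by omega] at this
    rw [this]
    congr 1
    omega
  · intro k k' hk hk' he
    have := ht (k' - (u.length + s₁'.length + v.length + s₂'.length)) (by omega)
    rw [show u.length + s₁'.length + v.length + s₂'.length +
      (k' - (u.length + s₁'.length + v.length + s₂'.length)) = k' by omega] at this
    rw [this]
    congr 1
    omega
  · intro k k' hk hk' he
    have := hq (k' - (u.length + s₁'.length + v.length + s₂'.length + t.length + s₃'.length))
      (by omega)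
    rw [show u.length + s₁'.length + v.length + s₂'.length + t.length + s₃'.length +
      (k' - (u.length + s₁'.length + v.length + s₂'.length + t.length + s₃'.length)) = k'
      by omega] at this
    rw [this]
    congr 1
    omega

theorem Move.exists_transports_right (m : Move D D') {C : Coloring D X} {f : ℕ → X}
    (h : IsEdgeColoring D'.word f)
    (hm : ∀ k k', m.Corresponds k k' → k' ≤ D'.word.length ∧ C.edgeColor k = f k') :
    ∃ C' : Coloring D' X, m.Transports C C' := by
  obtain ⟨C', hC'⟩ := h.exists_coloring
  exact ⟨C', fun k k' hk => (hm k k' hk).2.trans (hC' k' (hm k k' hk).1).symm⟩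

theorem Move.exists_transports_left (m : Move D D') {C : Coloring D' X} {f : ℕ → X}
    (h : IsEdgeColoring D.word f)
    (hm : ∀ k k', m.Corresponds k k' → k ≤ D.word.length ∧ C.edgeColor k' = f k) :
    ∃ C' : Coloring D X, m.Transports C' C := by
  obtain ⟨C', hC'⟩ := h.exists_coloring
  exact ⟨C', fun k k' hk => (hC' k (hm k k' hk).1).trans (hm k k' hk).2.symm⟩

theorem IsEdgeColoring.rename {w : Word} {f : ℕ → X} (h : IsEdgeColoring w f)
    (σ : Equiv.Perm ℕ) :
    IsEdgeColoring (w.map fun l => ⟨σ l.crossing, l.isOver, l.positive⟩) f := by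
  obtain ⟨h0, g, hg⟩ := h
  refine ⟨by rwa [List.length_map], g ∘ σ.symm, fun i l hi => ?_⟩
  rw [List.getElem?_map, Option.map_eq_some_iff] at hi
  obtain ⟨l, hl, rfl⟩ := hi
  simpa [PassageRel] using hg i l hl

/-- The old base point becomes an inner seam, where the colors match because the coloring closed up.
-/
theorem IsEdgeColoring.rotate {u v : Word} {f : ℕ → X} (h : IsEdgeColoring (u ++ v) f) :
    ∃ f', IsEdgeColoring (v ++ u) f' ∧ (∀ k ≤ v.length, f' k = f (u.length + k)) ∧
      ∀ k ≤ u.length, f' (v.length + k) = f k := by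
  obtain ⟨h0, g, hg⟩ := h
  rw [List.length_append] at h0
  obtain ⟨hu, hv⟩ := pathColoring_append.1 hg
  obtain ⟨f', hf', h₁, h₂⟩ := hv.glue hu h0.symm
  refine ⟨f', ⟨?_, g, hf'⟩, h₁, h₂⟩
  rw [List.length_append, h₁ 0 (by omega), h₂ _ le_rfl, add_zero]

theorem perm_gather (u v t q s₁ s₂ s₃ : Word) :
    (u ++ s₁ ++ v ++ s₂ ++ t ++ s₃ ++ q).Perm ((u ++ v ++ t ++ q) ++ (s₁ ++ s₂ ++ s₃)) := by
  rw [← Multiset.coe_eq_coe]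
  simp only [← Multiset.coe_add]
  abel

theorem length_eq_two_of_triangle {x y z : ℕ} {α β γ s : Bool} {w : Word}
    (hw : w ∈ triangleStrands x y z α β γ s) : w.length = 2 := by
  simp only [triangleStrands, List.mem_cons, List.not_mem_nil, or_false] at hw
  rcases hw with rfl | rfl | rfl
  · cases α <;> rfl
  · cases β <;> rfl
  · cases γ <;> rfl

/-- Phrased for the word of one diagram instead of a move, so that it serves type III in both
directions. -/
theorem exists_isEdgeColoring_triangle {u v t q s₁ s₂ s₃ : Word} {x y z : ℕ} {α β γ s : Bool}
    (hs : [s₁, s₂, s₃].Perm (triangleStrands x y z α β γ s))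
    (hw : D.word = u ++ s₁ ++ v ++ s₂ ++ t ++ s₃ ++ q) (C : Coloring D X) :
    ∃ f', IsEdgeColoring
        (u ++ s₁.reverse ++ v ++ s₂.reverse ++ t ++ s₃.reverse ++ q) f' ∧
      ∀ k ≤ D.word.length, k ≠ u.length + 1 → k ≠ u.length + 2 + v.length + 1 →
        k ≠ u.length + 2 + v.length + 2 + t.length + 1 → C.edgeColor k = f' k := by
  obtain ⟨h0, g, hg⟩ := C.isEdgeColoring
  have hmem : ∀ w ∈ [s₁, s₂, s₃], w ∈ triangleStrands x y z α β γ s := fun w hw => hs.subset hw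
  have m₁ := hmem s₁ (by simp)
  have m₂ := hmem s₂ (by simp)
  have m₃ := hmem s₃ (by simp)
  have hperm := hw ▸ perm_gather u v t q s₁ s₂ s₃
  have hflat : (s₁ ++ s₂ ++ s₃).Perm (triangleStrands x y z α β γ s).flatten := by
    simpa using hs.flatten
  have hnodup : (((triangleStrands x y z α β γ s).flatten).map
      fun l => (l.crossing, l.isOver)).Nodup := by
    have := (hperm.map fun l : Letter => (l.crossing, l.isOver)).nodup_iff.1 D.nodup
    rw [List.map_append] at this
    exact ((hflat.map _).nodup_iff).1 (List.nodup_append.1 this).2.1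
  -- Otherwise the over-passage of `z` would occur twice in the three strands.
  have hne : x ≠ z ∧ y ≠ z := by
    cases α <;> cases β <;> cases γ <;> simp [triangleStrands, inOrder] at hnodup <;> tauto
  have hz : ∀ l ∈ u ++ v ++ t ++ q, l.crossing ≠ z := by
    refine crossing_ne_of_nodup D.nodup hperm fun o => ?_
    simp only [hflat.mem_iff]
    cases o
    · exact ⟨⟨z, false, (β == γ) == s⟩, by cases γ <;> simp [triangleStrands, inOrder], rfl, rfl⟩
    · exact ⟨⟨z, true, (β == γ) == s⟩, by cases β <;> simp [triangleStrands, inOrder], rfl, rfl⟩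
  obtain ⟨r₁, r₂, r₃⟩ := PathColoring.strands (hw ▸ hg)
  have hxy : g x = g y := by
    have : inOrder α ⟨x, true, (α == β) == s⟩ ⟨y, true, (α == γ) == s⟩ ∈ [s₁, s₂, s₃] :=
      hs.symm.subset (by simp [triangleStrands])
    simp only [List.mem_cons, List.not_mem_nil, or_false] at this
    rcases this with h | h | h
    · exact eq_of_strandRel_top (h ▸ r₁)
    · exact eq_of_strandRel_top (h ▸ r₂)
    · exact eq_of_strandRel_top (h ▸ r₃)
  have l₁ := length_eq_two_of_triangle m₁
  have l₂ := length_eq_two_of_triangle m₂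
  have l₃ := length_eq_two_of_triangle m₃
  obtain ⟨f', hf', hu, hv, ht, hq⟩ := IsEdgeColoring.replace (triangleColors g x z α s) hw rfl
    h0 hg (fun l hl => Function.update_of_ne (hz l hl) _ _)
    (strandRel_triangle hxy hne.1 hne.2 m₁ r₁) (strandRel_triangle hxy hne.1 hne.2 m₂ r₂)
    (strandRel_triangle hxy hne.1 hne.2 m₃ r₃)
  refine ⟨f', hf', fun k hk k₁ k₂ k₃ => ?_⟩
  simp only [hw, List.length_append, List.length_reverse, l₁, l₂, l₃] at hk hu hv ht hq
  rcases le_or_gt k u.length with h | h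
  · exact hu k k h rfl
  rcases le_or_gt k (u.length + 2 + v.length) with h | h
  · exact hv k k (by omega) h rfl
  rcases le_or_gt k (u.length + 2 + v.length + 2 + t.length) with h | h
  · exact ht k k (by omega) h rfl
  · exact hq k k (by omega) (by omega) rfl

/-- The over-strand gives both crossings the same over-arc color, which makes the under-strand
trivial; so both strands can be deleted. -/
theorem eq_of_strandRel_bigon {a b : ℕ} {ε : Bool} {s₁ s₂ : Word} {g : ℕ → X} {p₁ r₁ p₂ r₂ : X}
    (hs : IsBigonPair a b ε s₁ s₂)
    (h₁ : StrandRel g s₁ p₁ r₁) (h₂ : StrandRel g s₂ p₂ r₂) : r₁ = p₁ ∧ r₂ = p₂ := by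
  have key : ∀ {s s' : Word} {p r p' r' : X}, s = bigonStrand a b true ε →
      (s' = bigonStrand a b false ε ∨ s' = (bigonStrand a b false ε).reverse) →
      StrandRel g s p r → StrandRel g s' p' r' → r = p ∧ r' = p' := by
    rintro s s' p r p' r' rfl hs' h h'
    obtain ⟨ha, hb, hr⟩ := strandRel_bigon_over.1 h
    rcases hs' with rfl | rfl
    · exact ⟨hr, (strandRel_bigon_under (ha.trans hb.symm)).1 h'⟩
    · exact ⟨hr, (strandRel_bigon_under_reverse (ha.trans hb.symm)).1 h'⟩
  rcases hs with ⟨h, h'⟩ | ⟨h, h'⟩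
  · exact key h h' h₁ h₂
  · exact (key h h' h₂ h₁).symm

/-- The color `c` is that of the over-strand: `p₁` or `p₂`, according to which strand runs over. -/
theorem exists_strandRel_bigon {a b : ℕ} {ε : Bool} {s₁ s₂ : Word} (p₁ p₂ : X)
    (hs : IsBigonPair a b ε s₁ s₂) :
    ∃ c, ∀ g : ℕ → X, g a = c → g b = c → StrandRel g s₁ p₁ p₁ ∧ StrandRel g s₂ p₂ p₂ := by
  have key : ∀ {s s' : Word} {p p' : X}, s = bigonStrand a b true ε →
      (s' = bigonStrand a b false ε ∨ s' = (bigonStrand a b false ε).reverse) →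
      ∀ g : ℕ → X, g a = p → g b = p → StrandRel g s p p ∧ StrandRel g s' p' p' := by
    rintro s s' p p' rfl hs' g ha hb
    refine ⟨strandRel_bigon_over.2 ⟨ha, hb, rfl⟩, ?_⟩
    rcases hs' with rfl | rfl
    · exact (strandRel_bigon_under (ha.trans hb.symm)).2 rfl
    · exact (strandRel_bigon_under_reverse (ha.trans hb.symm)).2 rfl
  rcases hs with ⟨h, h'⟩ | ⟨h, h'⟩
  · exact ⟨p₁, key h h'⟩
  · exact ⟨p₂, fun g ha hb => (key h h' g ha hb).symm⟩

theorem exists_letter_of_bigon {a b : ℕ} {ε : Bool} {s₁ s₂ : Word}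
    (hs : IsBigonPair a b ε s₁ s₂)
    {c : ℕ} (hc : c = a ∨ c = b) (o : Bool) :
    ∃ l ∈ s₁ ++ s₂, l.crossing = c ∧ l.isOver = o := by
  rcases hs with ⟨rfl, rfl | rfl⟩ | ⟨rfl, rfl | rfl⟩ <;> rcases hc with rfl | rfl <;>
    cases o <;> simp [bigonStrand]

theorem Move.exists_right (m : Move D D') (C : Coloring D X) :
    ∃ C' : Coloring D' X, m.Transports C C' := by
  classical
  obtain ⟨h0, g, hg⟩ := C.isEdgeColoring
  cases m with
  | rename σ hw' ho =>
    refine Move.exists_transports_right _ (f := C.edgeColor)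
      (hw' ▸ C.isEdgeColoring.rename σ) ?_
    rintro k k' ⟨hk, rfl⟩
    exact ⟨by rwa [hw', List.length_map], rfl⟩
  | rebase u v hw hw' ho =>
    obtain ⟨f, hf, hv, hu⟩ := IsEdgeColoring.rotate (hw ▸ C.isEdgeColoring)
    refine Move.exists_transports_right _ (f := f) (hw' ▸ hf) ?_
    rw [hw', List.length_append]
    rintro k k' (⟨hk, rfl⟩ | ⟨hk, rfl⟩)
    · exact ⟨by omega, (hu k hk).symm⟩
    · exact ⟨by omega, (hv k' hk).symm⟩
  | typeI u v c o ε hw hw' ho =>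
    have hc : ∀ l ∈ u ++ v, l.crossing ≠ c := by
      have hp := perm_gather u v [] [] [⟨c, o, ε⟩, ⟨c, !o, ε⟩] [] []
      simp only [List.append_nil] at hp
      refine crossing_ne_of_nodup D'.nodup (hw' ▸ hp) fun o' => ?_
      cases o <;> cases o' <;> simp
    -- A kink replaces an empty strand; its new crossing gets as over-arc color that of the edge it
    -- sits on.
    obtain ⟨f, hf, hu, hv, -⟩ := IsEdgeColoring.replace (s₁' := [⟨c, o, ε⟩, ⟨c, !o, ε⟩])
      (u := u) (v := v) (t := []) (q := []) (s₁ := []) (s₂ := []) (s₃ := []) (s₂' := [])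
      (s₃' := []) (w' := D'.word) (Function.update g c (C.edgeColor u.length)) (by simpa using hw)
      (by simpa using hw') h0 hg (fun l hl => Function.update_of_ne (hc l (by simpa using hl)) _ _)
      (strandRel_kink (Function.update_self ..) o ε) (strandRel_nil.2 rfl) (strandRel_nil.2 rfl)
    refine Move.exists_transports_right _ hf fun k k' hk => ?_
    simp only [Move.Corresponds, hw, hw', List.length_append, List.length_cons,
      List.length_nil] at hk hu hv ⊢
    rcases hk with ⟨hk, rfl⟩ | ⟨hk, hk', rfl⟩
    · exact ⟨by omega, hu _ _ hk rfl⟩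
    · exact ⟨by omega, hv _ _ (by omega) (by omega) (by omega)⟩
  | typeII u v t a b ε s₁ s₂ hs hw hw' ho =>
    replace hs := isBigonPair_of_perm hs
    obtain ⟨l₁, l₂⟩ := length_eq_two_of_bigon hs
    have hc : ∀ c, c = a ∨ c = b → ∀ l ∈ u ++ v ++ t, l.crossing ≠ c := by
      intro c hc
      have hp := perm_gather u v t [] s₁ s₂ []
      simp only [List.append_nil] at hp
      exact crossing_ne_of_nodup D'.nodup (hw' ▸ hp) (exists_letter_of_bigon hs hc)
    obtain ⟨c, hc'⟩ := exists_strandRel_bigon (C.edgeColor u.length)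
      (C.edgeColor (u.length + v.length)) hs
    -- Both new crossings get the color of the over-strand; their names are fresh outside the disc,
    -- so the rest of the word is unaffected.
    obtain ⟨r₁, r₂⟩ := hc' (fun n => if n = a ∨ n = b then c else g n) (by simp) (by simp)
    obtain ⟨f, hf, hu, hv, ht, -⟩ := IsEdgeColoring.replace (s₁' := s₁) (s₂' := s₂)
      (u := u) (v := v) (t := t) (q := []) (s₁ := []) (s₂ := []) (s₃ := [])
      (s₃' := []) (w' := D'.word) (fun n => if n = a ∨ n = b then c else g n)
      (by simpa using hw) (by simpa using hw') h0 hg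
      (fun l hl => if_neg fun h => hc _ h l (by simpa using hl) rfl)
      r₁ r₂ (strandRel_nil.2 rfl)
    refine Move.exists_transports_right _ hf fun k k' hk => ?_
    simp only [Move.Corresponds, hw, hw', List.length_append, l₁, l₂,
      List.length_nil] at hk hu hv ht ⊢
    rcases hk with ⟨hk, rfl⟩ | ⟨hk, hk', rfl⟩ | ⟨hk, hk', rfl⟩
    · exact ⟨by omega, hu _ _ hk rfl⟩
    · exact ⟨by omega, hv _ _ (by omega) (by omega) (by omega)⟩
    · exact ⟨by omega, ht _ _ (by omega) (by omega) (by omega)⟩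
  | typeIII u v t q x y z α β γ s s₁ s₂ s₃ hs hw hw' ho =>
    obtain ⟨f, hf, h⟩ := exists_isEdgeColoring_triangle hs hw C
    refine Move.exists_transports_right _ (f := f) (hw' ▸ hf) ?_
    rintro k _ ⟨hk, rfl, k₁, k₂, k₃⟩
    refine ⟨?_, h _ hk k₁ k₂ k₃⟩
    simpa [hw, hw'] using hk

theorem Move.exists_left (m : Move D D') (C : Coloring D' X) :
    ∃ C' : Coloring D X, m.Transports C' C := by
  obtain ⟨h0, g, hg⟩ := C.isEdgeColoring
  cases m with
  | rename σ hw' ho =>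
    have h := C.isEdgeColoring.rename σ.symm
    have hw : D'.word.map (fun l => ⟨σ.symm l.crossing, l.isOver, l.positive⟩) = D.word := by
      rw [hw', List.map_map]
      exact (List.map_congr_left fun l _ => by simp).trans (List.map_id _)
    refine Move.exists_transports_left _ (hw ▸ h) ?_
    rintro k k' ⟨hk, rfl⟩
    exact ⟨hk, rfl⟩
  | rebase u v hw hw' ho =>
    obtain ⟨f, hf, hu, hv⟩ := IsEdgeColoring.rotate (hw' ▸ C.isEdgeColoring)
    refine Move.exists_transports_left _ (f := f) (hw ▸ hf) ?_
    rw [hw, List.length_append]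
    rintro k k' (⟨hk, rfl⟩ | ⟨hk, rfl⟩)
    · exact ⟨by omega, (hu k hk).symm⟩
    · exact ⟨by omega, (hv k' hk).symm⟩
  | typeI u v c o ε hw hw' ho =>
    have hw'' : D'.word = u ++ [⟨c, o, ε⟩, ⟨c, !o, ε⟩] ++ v ++ [] ++ [] ++ [] ++ [] := by
      simpa using hw'
    -- The old over-arc colors are kept; the kink has equal end colors, so it can be replaced by the
    -- empty strand.
    obtain ⟨r₁, -⟩ := PathColoring.strands (hw'' ▸ hg)
    obtain ⟨f, hf, hu, hv, -⟩ := IsEdgeColoring.replace (s₁' := []) (s₂' := [])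
      (s₃' := []) (w' := D.word) g hw'' (by simpa using hw) h0 hg (fun _ _ => rfl)
      (strandRel_nil.2 (eq_of_strandRel_kink r₁)) (strandRel_nil.2 rfl) (strandRel_nil.2 rfl)
    refine Move.exists_transports_left _ hf fun k k' hk => ?_
    simp only [Move.Corresponds, hw, List.length_append, List.length_cons,
      List.length_nil] at hk hu hv ⊢
    rcases hk with ⟨hk, rfl⟩ | ⟨hk, hk', rfl⟩
    · exact ⟨by omega, hu _ _ hk rfl⟩
    · exact ⟨by omega, hv _ _ (by omega) (by omega) (by omega)⟩
  | typeII u v t a b ε s₁ s₂ hs hw hw' ho =>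
    replace hs := isBigonPair_of_perm hs
    obtain ⟨l₁, l₂⟩ := length_eq_two_of_bigon hs
    have hw'' : D'.word = u ++ s₁ ++ v ++ s₂ ++ t ++ [] ++ [] := by simpa using hw'
    obtain ⟨r₁, r₂, -⟩ := PathColoring.strands (hw'' ▸ hg)
    obtain ⟨e₁, e₂⟩ := eq_of_strandRel_bigon hs r₁ r₂
    obtain ⟨f, hf, hu, hv, ht, -⟩ := IsEdgeColoring.replace (s₁' := []) (s₂' := [])
      (s₃' := []) (w' := D.word) g hw'' (by simpa using hw) h0 hg (fun _ _ => rfl)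
      (strandRel_nil.2 e₁) (strandRel_nil.2 e₂) (strandRel_nil.2 rfl)
    refine Move.exists_transports_left _ hf fun k k' hk => ?_
    simp only [Move.Corresponds, hw, List.length_append, l₁, l₂,
      List.length_nil] at hk hu hv ht ⊢
    rcases hk with ⟨hk, rfl⟩ | ⟨hk, hk', rfl⟩ | ⟨hk, hk', rfl⟩
    · exact ⟨by omega, hu _ _ hk rfl⟩
    · exact ⟨by omega, hv _ _ (by omega) (by omega) (by omega)⟩
    · exact ⟨by omega, ht _ _ (by omega) (by omega) (by omega)⟩
  | typeIII u v t q x y z α β γ s s₁ s₂ s₃ hs hw hw' ho =>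
    have hs' : [s₁.reverse, s₂.reverse, s₃.reverse].Perm
        (triangleStrands x y z (!α) (!β) (!γ) s) :=
      triangleStrands_reverse x y z α β γ s ▸ hs.map List.reverse
    obtain ⟨f, hf, h⟩ := exists_isEdgeColoring_triangle hs' hw' C
    simp only [List.reverse_reverse] at hf
    refine Move.exists_transports_left _ (f := f) (hw ▸ hf) ?_
    rintro k _ ⟨hk, rfl, k₁, k₂, k₃⟩
    refine ⟨hk, h _ ?_ k₁ k₂ k₃⟩
    simpa [hw, hw'] using hk

end Existence

/-! ### Bijections of colorings and the multiset of classes -/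

section Bijection

variable {D D' : Diagram} {X : Type*} [Quandle X]

/-- A move takes each coloring to exactly one coloring, bijectively. -/
theorem Move.exists_equiv (m : Move D D') (X : Type*) [Quandle X] :
    ∃ ψ : Coloring D X ≃ Coloring D' X, ∀ C C', m.Transports C C' ↔ ψ C = C' := by
  choose φ hφ using fun C : Coloring D X => m.exists_right C
  choose φ' hφ' using fun C : Coloring D' X => m.exists_left C
  -- Uniqueness on either side makes the two chosen maps mutually inverse.
  refine ⟨⟨φ, φ', fun C => m.transports_left_unique (hφ' _) (hφ C),
    fun C => m.transports_right_unique (hφ _) (hφ' C)⟩, fun C C' => ⟨fun h => ?_, ?_⟩⟩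
  · exact m.transports_right_unique (hφ C) h
  · rintro rfl
    exact hφ C

/-- A sequence of moves takes each coloring to exactly one coloring, bijectively. -/
theorem MoveSeq.exists_equiv (l : MoveSeq D D') (X : Type*) [Quandle X] :
    ∃ ψ : Coloring D X ≃ Coloring D' X, ∀ C C', l.Transports C C' ↔ ψ C = C' := by
  induction l with
  | nil D => exact ⟨Equiv.refl _, fun C C' => Iff.rfl⟩
  | cons m l ih =>
    obtain ⟨ψ, hψ⟩ := ih
    obtain ⟨φ, hφ⟩ := m.exists_equiv X
    refine ⟨φ.trans ψ, fun C C' => ?_⟩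
    simp [MoveSeq.Transports, hφ, hψ]
  | consInv m l ih =>
    obtain ⟨ψ, hψ⟩ := ih
    obtain ⟨φ, hφ⟩ := m.exists_equiv X
    refine ⟨φ.symm.trans ψ, fun C C' => ?_⟩
    simp only [MoveSeq.Transports, hφ, hψ, ← Equiv.eq_symm_apply φ, exists_eq_left,
      Equiv.trans_apply]

theorem MoveSeq.Transports.toClass_eq {l : MoveSeq D D'} {C : Coloring D X}
    {C' : Coloring D' X} (h : l.Transports C C') {K : Knot} (hD : D.knot = K)
    (hD' : D'.knot = K) : C'.toClass hD' = C.toClass hD :=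
  Eq.symm (Quotient.sound ⟨l, h⟩)

theorem Diagram.coloringClasses_eq_of_equiv [Finite X] {K : Knot} (hD : D.knot = K)
    (hD' : D'.knot = K) (ψ : Coloring D X ≃ Coloring D' X)
    (h : ∀ C, (ψ C).toClass hD' = C.toClass hD) :
    D.coloringClasses hD X = D'.coloringClasses hD' X := by
  let _ : Fintype (Coloring D X) := Fintype.ofFinite _
  let _ : Fintype (Coloring D' X) := Fintype.ofFinite _
  unfold Diagram.coloringClasses
  rw [← Finset.map_univ_equiv ψ, Finset.map_val, Multiset.map_map]
  exact Multiset.map_congr rfl fun C _ => (h C).symm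

end Bijection

end Knots

open Knots in
theorem mainTheorem1 (X : Type*) [Quandle X] [Finite X] (K : Knot) (D D' : Diagram)
    (hD : D.knot = K) (hD' : D'.knot = K) :
    (∀ l : MoveSeq D D', ∃ ψ : Coloring D X ≃ Coloring D' X,
      (∀ (C : Coloring D X) (C' : Coloring D' X), l.Transports C C' ↔ ψ C = C') ∧
      ∀ C : Coloring D X, (ψ C).toClass hD' = C.toClass hD) ∧
    D.coloringClasses hD X = D'.coloringClasses hD' X := by
  have key : ∀ l : MoveSeq D D', ∃ ψ : Coloring D X ≃ Coloring D' X,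
      (∀ (C : Coloring D X) (C' : Coloring D' X), l.Transports C C' ↔ ψ C = C') ∧
      ∀ C : Coloring D X, (ψ C).toClass hD' = C.toClass hD := by
    intro l
    obtain ⟨ψ, hψ⟩ := l.exists_equiv X
    exact ⟨ψ, hψ, fun C => ((hψ C _).2 rfl).toClass_eq hD hD'⟩
  refine ⟨key, ?_⟩
  -- Diagrams of the same knot are joined by some sequence of moves, and any one of them will do.
  obtain ⟨l⟩ : Nonempty (MoveSeq D D') := Quotient.exact (hD.trans hD'.symm)
  obtain ⟨ψ, -, hψ⟩ := key l
  exact Diagram.coloringClasses_eq_of_equiv hD hD' ψ hψ
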